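/- All rings are commutative with identity. For a ring $A$ let $\mathrm{Reg}(A)$ be its set of regular elements (non-zero-divisors) and $K=\mathrm{Reg}(A)^{-1}A$ its total quotient ring. An overring of $A$ is a ring $B$ with $A\subseteq B\subseteq K$; the ring $A$ is \emph{perinormal} if every overring $B$ of $A$ such that $A\subseteq B$ satisfies going down is flat as an $A$-module. An ideal is \emph{regular} if it contains a regular element, and $A$ is a \emph{Marot ring} if every regular ideal of $A$ is generated by regular elements. For a prime ideal $P$ let $A_{(P)}\subseteq K$ be the fraction ring of $A$ with denominators in $(A\setminus P)\cap \mathrm{Reg}(A)$. Let $H$ be the set of minimal regular primes of $A$, that is, the minimal elements of the set of regular prime ideals. The ring $A$ is a \emph{Krull ring} if (1) $A=\bigcap_{P\in H}A_{(P)}$ (the empty intersection being $K$); (2) each $x\in\mathrm{Reg}(A)$ belongs to only finitely many $P\in H$; (3) for each $P\in H$, $A_{(P)}$ is a discrete (Manis) valuation ring, i.e. there is a surjective map $v:K\to\mathbb{Z}\cup\{\infty\}$ with $v(xy)=v(x)+v(y)$, $v(x+y)\ge\min\{v(x),v(y)\}$, $v(1)=0$, $v(0)=\infty$ and $A_{(P)}=\{x\in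 K\mid v(x)\ge 0\}$. Every Marot ring that is a Krull ring is perinormal. In particular, if $R$ is any Noetherian ring (not necessarily reduced), then the integral closure of $R$ in its total quotient ring is perinormal. -/

import Mathlib

open scoped nonZeroDivisors WithZero

namespace ZeroDivisorRing

/-- An ideal is regular if it contains a regular element (a non-zero-divisor). -/
def IsRegularIdeal {A : Type*} [CommRing A] (I : Ideal A) : Prop :=
  ∃ r ∈ I, r ∈ A⁰

/-- A Marot ring: every regular ideal is generated by its regular elements. -/
def IsMarotRing (A : Type*) [CommRing A] : Prop :=
  ∀ I : Ideal A, IsRegularIdeal I → Ideal.span {r : A | r ∈ I ∧ r ∈ A⁰} = I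

/-- The regular quotient ring `A_(P)`: the fraction ring of `A` with denominators in
`(A - P) ∩ Reg(A)`, as an overring of `A` inside the total quotient ring of `A`. -/
noncomputable def regularQuotientRing (A : Type*) [CommRing A] (P : PrimeSpectrum A) :
    Subalgebra A (FractionRing A) :=
  Localization.subalgebra (FractionRing A) (P.asIdeal.primeCompl ⊓ A⁰) inf_le_right

/-- The minimal regular primes: the minimal elements of the set of regular primes. -/
def minimalRegularPrimes (A : Type*) [CommRing A] : Set (PrimeSpectrum A) :=
  {P | Minimal (fun Q : PrimeSpectrum A => IsRegularIdeal Q.asIdeal) P}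

/-- An overring `B` of `A` is a (Manis) discrete valuation ring: it is the ring of a surjective
valuation `K → ℤ ∪ {∞}` on the total quotient ring `K` of `A`. In Mathlib's multiplicative
convention `∞` is `0 : ℤᵐ⁰` and `v x ≥ 0` reads `v x ≤ 1`. -/
def IsManisDVR {A : Type*} [CommRing A] (B : Subalgebra A (FractionRing A)) : Prop :=
  ∃ v : Valuation (FractionRing A) ℤᵐ⁰, Function.Surjective v ∧ ∀ x, x ∈ B ↔ v x ≤ 1

/-- Krull rings (possibly with zero-divisors). The bottom subalgebra is (the image of) `A`. -/
structure IsKrullRing (A : Type*) [CommRing A] : Prop where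
  iInf_eq_bot : ⨅ P ∈ minimalRegularPrimes A, regularQuotientRing A P = ⊥
  finite_character : ∀ x ∈ A⁰, {P ∈ minimalRegularPrimes A | x ∈ P.asIdeal}.Finite
  isManisDVR : ∀ P ∈ minimalRegularPrimes A, IsManisDVR (regularQuotientRing A P)

/-- A ring `A` is perinormal if every overring of `A` (ring between `A` and its total quotient
ring) which satisfies going down over `A` is flat as an `A`-module. -/
def IsPerinormal (A : Type*) [CommRing A] : Prop :=
  ∀ B : Subalgebra A (FractionRing A), Algebra.HasGoingDown A B → Module.Flat A B

end ZeroDivisorRing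

/-!
For `x` in the total quotient ring `K` of `A`, let `(A : x)` be the ideal of all `a` with
`a • x ∈ A`. An overring `B` is flat over `A` once `(A : b) B = B` for every `b ∈ B`. If this fails,
then `(A : b)` lies in the contraction `P` of a maximal ideal of `B`, and going down fails as soon
as there are a prime `Q ≤ P` and `a ∈ Q` with `a • b ∈ A \ Q`, since a prime of `B` over `Q`
contains `a • b`. Such `Q` and `a` exist for every `x ∈ K` and every prime `P` above `(A : x)`:

* For a Krull Marot ring, finite character gives a minimal regular prime `Q ≤ P` with
  `x ∉ A_(Q)`, and an element of value inverse to that of `x` gives `a`.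
* For `A` integrally closed and integral over a Noetherian ring `R`, take `Q ≤ P` minimal over
  `(A : x)`. Without a suitable `a`, every polynomial over `A` vanishing at a multiple `s • x` with
  `s ∉ Q` has its coefficients in `Q`. But for some such `s` a power of `p = Q ∩ R` multiplies
  `s • x` into `A`. Hence, for a suitable finite `R`-subalgebra `S` of `A` and a regular `d ∈ S`
  with `d • x ∈ S`, the argument of the Krull–Akizuki theorem makes `S[s • x] / d S[s • x]`
  Noetherian at `p`, and this yields a relation for `s • x` with a coefficient outside `Q`.
-/

open Polynomial

namespace ZeroDivisorRing

section Denominator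

variable {A K : Type*} [CommRing A] [CommRing K] [Algebra A K]

/-- The ideal `(A : x)` of all `a : A` such that `a • x` lies in the image of `A`; flatness of an
overring is tested on the extensions of these ideals. The algebra `K` need not be a ring of
fractions, so that the notion also applies to an overring or a subalgebra. -/
def denominatorIdeal (A : Type*) {K : Type*} [CommRing A] [CommRing K] [Algebra A K] (x : K) :
    Ideal A :=
  (1 : Submodule A K).colon {x}

theorem mem_denominatorIdeal {x : K} {a : A} :
    a ∈ denominatorIdeal A x ↔ ∃ y, algebraMap A K y = a • x := by
  rw [denominatorIdeal, Submodule.mem_colon_singleton, Submodule.mem_one]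

theorem mem_denominatorIdeal_smul {x : K} {a s : A} :
    a ∈ denominatorIdeal A (s • x) ↔ a * s ∈ denominatorIdeal A x := by
  simp only [mem_denominatorIdeal, mul_smul]

theorem denominatorIdeal_algebraMap (a : A) : denominatorIdeal A (algebraMap A K a) = ⊤ :=
  (Ideal.eq_top_iff_one _).mpr (mem_denominatorIdeal.mpr ⟨a, (one_smul A _).symm⟩)

theorem denominatorIdeal_inf_le_add (x y : K) :
    denominatorIdeal A x ⊓ denominatorIdeal A y ≤ denominatorIdeal A (x + y) := by
  rintro a ⟨hx, hy⟩
  obtain ⟨x', hx'⟩ := mem_denominatorIdeal.mp hx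
  obtain ⟨y', hy'⟩ := mem_denominatorIdeal.mp hy
  exact mem_denominatorIdeal.mpr ⟨x' + y', by rw [map_add, hx', hy', smul_add]⟩

theorem denominatorIdeal_mul_le (x y : K) :
    denominatorIdeal A x * denominatorIdeal A y ≤ denominatorIdeal A (x * y) := by
  refine Ideal.mul_le.mpr fun a hx b hy ↦ ?_
  obtain ⟨x', hx'⟩ := mem_denominatorIdeal.mp hx
  obtain ⟨y', hy'⟩ := mem_denominatorIdeal.mp hy
  exact mem_denominatorIdeal.mpr ⟨x' * y', by rw [map_mul, hx', hy', smul_mul_smul_comm]⟩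

theorem denominatorIdeal_pow_le (x : K) (n : ℕ) :
    denominatorIdeal A x ^ n ≤ denominatorIdeal A (x ^ n) := by
  induction n with
  | zero =>
    rw [pow_zero x, ← map_one (algebraMap A K), denominatorIdeal_algebraMap]
    exact le_top
  | succ n ih =>
    rw [pow_succ, pow_succ]
    exact (Ideal.mul_mono_left ih).trans (denominatorIdeal_mul_le _ _)

theorem exists_pow_le_denominatorIdeal_aeval {I : Ideal A} {x : K} {n : ℕ}
    (h : I ^ n ≤ denominatorIdeal A x) (f : A[X]) :
    ∃ e, I ^ e ≤ denominatorIdeal A (aeval x f) := by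
  induction f using Polynomial.induction_on' with
  | add f g hf hg =>
    obtain ⟨i, hi⟩ := hf
    obtain ⟨j, hj⟩ := hg
    rw [map_add]
    exact ⟨max i j, (le_inf ((Ideal.pow_le_pow_right (le_max_left i j)).trans hi)
      ((Ideal.pow_le_pow_right (le_max_right i j)).trans hj)).trans
        (denominatorIdeal_inf_le_add _ _)⟩
  | monomial k a =>
    refine ⟨n * k, ?_⟩
    calc I ^ (n * k) = (I ^ n) ^ k := pow_mul _ _ _
      _ ≤ denominatorIdeal A x ^ k := Ideal.pow_right_mono h k
      _ ≤ denominatorIdeal A (x ^ k) := denominatorIdeal_pow_le x k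
      _ = denominatorIdeal A (algebraMap A K a) * denominatorIdeal A (x ^ k) := by
        rw [denominatorIdeal_algebraMap, Ideal.top_mul]
      _ ≤ denominatorIdeal A (aeval x (monomial k a)) := by
        rw [aeval_monomial]
        exact denominatorIdeal_mul_le _ _

theorem exists_mem_nonZeroDivisors_mem_denominatorIdeal [IsFractionRing A K] (x : K) :
    ∃ d ∈ A⁰, d ∈ denominatorIdeal A x := by
  obtain ⟨c, d, rfl⟩ := IsLocalization.exists_mk'_eq A⁰ x
  exact ⟨d, d.2, mem_denominatorIdeal.mpr
    ⟨c, by rw [Algebra.smul_def, IsLocalization.mk'_spec']⟩⟩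

end Denominator

section Flat

open TensorProduct

variable {A B : Type*} [CommRing A] [CommRing B] [Algebra A B]

theorem map_colon_range_mk_one_eq_top
    (h : ∀ b : B, (denominatorIdeal A b).map (algebraMap A B) = ⊤)
    {N : Type*} [AddCommGroup N] [Module A N] (z : B ⊗[A] N) :
    ((LinearMap.range (TensorProduct.mk A B N 1)).colon {z}).map (algebraMap A B) = ⊤ := by
  induction z with
  | zero => rw [Submodule.colon_singleton_zero, Ideal.map_top]
  | tmul b n =>
    refine top_le_iff.mp ((h b).symm.trans_le (Ideal.map_mono fun a ha ↦ ?_))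
    obtain ⟨c, hc⟩ := mem_denominatorIdeal.mp ha
    refine Submodule.mem_colon_singleton.mpr ⟨c • n, ?_⟩
    rw [mk_apply, tmul_smul, smul_tmul', smul_tmul', ← hc, Algebra.algebraMap_eq_smul_one]
  | add z w hz hw =>
    rw [← top_le_iff, ← Ideal.top_mul ⊤]
    nth_rewrite 1 [← hz]
    rw [← hw, ← Ideal.map_mul]
    refine Ideal.map_mono (Ideal.mul_le_inf.trans fun a ⟨ha, hb⟩ ↦ ?_)
    rw [SetLike.mem_coe, Submodule.mem_colon_singleton] at ha hb
    rw [Submodule.mem_colon_singleton, smul_add]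
    exact add_mem ha hb

theorem flat_of_map_denominatorIdeal_eq_top (hinj : Function.Injective (algebraMap A B))
    (h : ∀ b : B, (denominatorIdeal A b).map (algebraMap A B) = ⊤) : Module.Flat A B := by
  refine Module.Flat.iff_lTensor_injective'.mpr fun I ↦
    (injective_iff_map_eq_zero _).mpr fun z hz ↦ ?_
  suffices hann : (LinearMap.range (TensorProduct.mk A B I 1)).colon {z} ≤
      (Ideal.comap (algebraMap A B) ((⊥ : Submodule B (B ⊗[A] I)).colon {z})) by
    have h1 := Ideal.map_le_iff_le_comap.mpr hann
    rw [map_colon_range_mk_one_eq_top h, top_le_iff, Ideal.eq_top_iff_one,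
      Submodule.mem_colon_singleton, one_smul] at h1
    exact h1
  intro a ha
  obtain ⟨i, hi⟩ := Submodule.mem_colon_singleton.mp ha
  have hi0 : algebraMap A B i = 0 := by
    have := congrArg (TensorProduct.rid A B ∘ I.subtype.lTensor B) hi
    simpa [hz, Algebra.algebraMap_eq_smul_one] using this
  rw [map_eq_zero_iff _ hinj, ZeroMemClass.coe_eq_zero] at hi0
  rw [Ideal.mem_comap, Submodule.mem_colon_singleton, Submodule.mem_bot, algebraMap_smul, ← hi,
    hi0, map_zero]

theorem flat_of_hasGoingDown {K : Type*} [CommRing K] [Algebra A K]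
    (hinj : Function.Injective (algebraMap A K))
    (h : ∀ (P : Ideal A) [P.IsPrime] (x : K), denominatorIdeal A x ≤ P →
      ∃ Q ≤ P, Q.IsPrime ∧ ∃ a ∈ Q, ∃ y ∉ Q, algebraMap A K y = a • x)
    (B : Subalgebra A K) [Algebra.HasGoingDown A B] : Module.Flat A B := by
  have hinjB : Function.Injective (algebraMap A B) :=
    Function.Injective.of_comp (f := algebraMap B K) hinj
  refine flat_of_map_denominatorIdeal_eq_top hinjB fun b ↦ ?_
  by_contra hb
  obtain ⟨M, hM, hbM⟩ := Ideal.exists_le_maximal _ hb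
  have hP : denominatorIdeal A (b : K) ≤ M.under A := fun s hs ↦ by
    obtain ⟨c, hc⟩ := mem_denominatorIdeal.mp hs
    exact hbM (Ideal.mem_map_of_mem _ (mem_denominatorIdeal.mpr ⟨c, Subtype.ext hc⟩))
  obtain ⟨Q, hQP, hQ, a, haQ, y, hyQ, hay⟩ := h (M.under A) b hP
  obtain ⟨Q', -, -, hover⟩ := Ideal.exists_ideal_le_liesOver_of_le (S := B) M hQP
  rw [Ideal.mem_of_liesOver Q' Q] at haQ hyQ
  have hyb : algebraMap A B y = algebraMap A B a * b :=
    Subtype.ext (hay.trans (Algebra.smul_def a (b : K)))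
  exact hyQ (hyb ▸ Q'.mul_mem_right _ haQ)

end Flat

section Krull

variable {A : Type*} [CommRing A]

theorem mem_regularQuotientRing_iff {P : PrimeSpectrum A} {x : FractionRing A} :
    x ∈ regularQuotientRing A P ↔ ∃ s ∉ P.asIdeal, s ∈ A⁰ ∧ s ∈ denominatorIdeal A x := by
  simp only [mem_denominatorIdeal]
  constructor
  · rintro ⟨a, s, hs, rfl⟩
    refine ⟨s, hs.1, hs.2, a, ?_⟩
    rw [Algebra.smul_def, IsLocalization.mk'_spec' _ a ⟨s, hs.2⟩]
  · rintro ⟨s, hsP, hs, a, h⟩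
    refine ⟨a, s, ⟨hsP, hs⟩, ?_⟩
    rw [IsLocalization.eq_mk'_iff_mul_eq, mul_comm, ← Algebra.smul_def, h]

theorem IsMarotRing.le_of_forall_mem_nonZeroDivisors (hA : IsMarotRing A)
    {I J : Ideal A} (hI : IsRegularIdeal I) (h : ∀ r ∈ I, r ∈ A⁰ → r ∈ J) : I ≤ J := by
  rw [← hA I hI, Ideal.span_le]
  exact fun r hr ↦ h r hr.1 hr.2

section Valuation

variable {Γ₀ : Type*} [LinearOrderedCommGroupWithZero Γ₀] {P : PrimeSpectrum A}
  {v : Valuation (FractionRing A) Γ₀}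

theorem valuation_algebraMap_le_one (hv : ∀ x, x ∈ regularQuotientRing A P ↔ v x ≤ 1) (a : A) :
    v (algebraMap A _ a) ≤ 1 :=
  (hv _).mp (Subalgebra.algebraMap_mem _ a)

theorem valuation_lt_one_iff_of_mem_nonZeroDivisors
    (hv : ∀ x, x ∈ regularQuotientRing A P ↔ v x ≤ 1) {s : A} (hs : s ∈ A⁰) :
    v (algebraMap A _ s) < 1 ↔ s ∈ P.asIdeal := by
  obtain ⟨u, hu⟩ := IsLocalization.map_units (FractionRing A) (⟨s, hs⟩ : A⁰)
  have hu : (u : FractionRing A) = algebraMap A _ s := hu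
  have hinv : (↑u⁻¹ : FractionRing A) ∈ regularQuotientRing A P ↔ s ∉ P.asIdeal := by
    simp only [mem_regularQuotientRing_iff, mem_denominatorIdeal]
    constructor
    · rintro ⟨t, htP, -, a, ha⟩ hsP
      have hts : a * s = t := by
        apply IsFractionRing.injective A (FractionRing A)
        rw [map_mul, ha, ← hu, Algebra.smul_def, mul_assoc, Units.inv_mul, mul_one]
      exact htP (hts ▸ P.asIdeal.mul_mem_left a hsP)
    · exact fun hsP ↦ ⟨s, hsP, hs, 1, by rw [map_one, Algebra.smul_def, ← hu, Units.mul_inv]⟩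
  have hmul : v (algebraMap A _ s) * v (↑u⁻¹ : FractionRing A) = 1 := by
    rw [← map_mul, ← hu, Units.mul_inv, map_one]
  rw [← not_iff_not, ← hinv, hv, not_lt]
  refine ⟨fun h ↦ ?_, fun h ↦ ?_⟩
  · exact (le_mul_of_one_le_left' h).trans_eq hmul
  · exact hmul.symm.le.trans (mul_le_of_le_one_right' h)

theorem valuation_lt_one_iff (hA : IsMarotRing A) (hP : IsRegularIdeal P.asIdeal)
    (hv : ∀ x, x ∈ regularQuotientRing A P ↔ v x ≤ 1) (a : A) :
    v (algebraMap A _ a) < 1 ↔ a ∈ P.asIdeal := by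
  let J : Ideal A :=
    { carrier := {a | v (algebraMap A _ a) < 1}
      add_mem' := fun {a b} ha hb ↦ by
        simp only [Set.mem_ofPred_eq, map_add] at *
        exact v.map_add_lt ha hb
      zero_mem' := by simp
      smul_mem' := fun c a ha ↦ by
        simp only [Set.mem_ofPred_eq, smul_eq_mul, map_mul] at *
        exact (mul_le_of_le_one_left' (valuation_algebraMap_le_one hv c)).trans_lt ha }
  have hPJ : P.asIdeal ≤ J := hA.le_of_forall_mem_nonZeroDivisors hP fun r hrP hr ↦
    (valuation_lt_one_iff_of_mem_nonZeroDivisors hv hr).mpr hrP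
  have hJ : IsRegularIdeal J := hP.imp fun r hr ↦ ⟨hPJ hr.1, hr.2⟩
  have hJP : J ≤ P.asIdeal := hA.le_of_forall_mem_nonZeroDivisors hJ fun r hrJ hr ↦
    (valuation_lt_one_iff_of_mem_nonZeroDivisors hv hr).mp hrJ
  exact ⟨fun h ↦ hJP h, fun h ↦ hPJ h⟩

theorem exists_pow_mul_le_one [MulArchimedean Γ₀] {c y : Γ₀} (hc : c < 1) :
    ∃ n : ℕ, c ^ n * y ≤ 1 := by
  rcases eq_or_ne c 0 with rfl | hc0
  · exact ⟨1, by simp⟩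
  obtain ⟨n, hn⟩ := MulArchimedean.arch y (one_lt_inv_iff₀.mpr ⟨zero_lt_iff.mpr hc0, hc⟩)
  refine ⟨n, (mul_le_mul_right hn (c ^ n)).trans_eq ?_⟩
  rw [← mul_pow, mul_inv_cancel₀ hc0, one_pow]

theorem IsManisDVR.exists_notMem_smul_mem (hA : IsMarotRing A) (hP : IsRegularIdeal P.asIdeal)
    (hD : IsManisDVR (regularQuotientRing A P)) {P' : Ideal A} [P'.IsPrime]
    (hPP' : ¬ P.asIdeal ≤ P') (x : FractionRing A) :
    ∃ s ∉ P', s • x ∈ regularQuotientRing A P := by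
  obtain ⟨v, -, hv⟩ := hD
  obtain ⟨s, hsP, hsP'⟩ := SetLike.not_le_iff_exists.mp hPP'
  obtain ⟨n, hn⟩ := exists_pow_mul_le_one (y := v x) ((valuation_lt_one_iff hA hP hv s).mpr hsP)
  refine ⟨s ^ n, fun h ↦ hsP' (Ideal.IsPrime.mem_of_pow_mem ‹_› _ h), ?_⟩
  rwa [hv, Algebra.smul_def, map_mul, map_pow, map_pow]

theorem IsManisDVR.exists_mem_smul_notMem (hA : IsMarotRing A) (hP : IsRegularIdeal P.asIdeal)
    (hD : IsManisDVR (regularQuotientRing A P)) {x : FractionRing A}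
    (hx : x ∉ regularQuotientRing A P) :
    ∃ a ∈ P.asIdeal, ∃ y ∉ P.asIdeal, algebraMap A _ y = a • x := by
  obtain ⟨v, hsurj, hv⟩ := hD
  have hone : ∀ s ∈ A⁰, s ∉ P.asIdeal → v (algebraMap A _ s) = 1 := fun s hs hsP ↦
    (valuation_algebraMap_le_one hv s).eq_of_not_lt fun h ↦
      hsP ((valuation_lt_one_iff_of_mem_nonZeroDivisors hv hs).mp h)
  have hvx : 1 < v x := by simpa [hv] using hx
  obtain ⟨w, hw⟩ := hsurj (v x)⁻¹
  have hw1 : v w < 1 := hw.trans_lt (inv_lt_one_of_one_lt₀ hvx)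
  have hwx : v (w * x) = 1 := by
    rw [map_mul, hw, inv_mul_cancel₀ (zero_lt_one.trans hvx).ne']
  obtain ⟨s, hsP, hs, hsw⟩ := mem_regularQuotientRing_iff.mp ((hv _).mpr hw1.le)
  obtain ⟨t, htP, ht, htwx⟩ := mem_regularQuotientRing_iff.mp ((hv _).mpr hwx.le)
  obtain ⟨a, ha⟩ := mem_denominatorIdeal.mp hsw
  obtain ⟨y, hy⟩ := mem_denominatorIdeal.mp htwx
  rw [Algebra.smul_def] at ha hy
  refine ⟨t * a, ?_, s * y, ?_, ?_⟩
  · rw [← valuation_lt_one_iff hA hP hv, map_mul, ha, map_mul, map_mul, hone s hs hsP,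
      hone t ht htP, one_mul, one_mul]
    exact hw1
  · rw [← valuation_lt_one_iff hA hP hv, map_mul, hy, map_mul, map_mul, hone s hs hsP,
      hone t ht htP, one_mul, one_mul, hwx]
    exact lt_irrefl _
  · rw [Algebra.smul_def, map_mul, map_mul, ha, hy]
    ring

end Valuation

theorem IsKrullRing.exists_minimalRegularPrime_le (hK : IsKrullRing A) (hA : IsMarotRing A)
    {P : Ideal A} [P.IsPrime] {x : FractionRing A} (hx : denominatorIdeal A x ≤ P) :
    ∃ Q ∈ minimalRegularPrimes A, Q.asIdeal ≤ P ∧ x ∉ regularQuotientRing A Q := by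
  classical
  by_contra! hcon
  obtain ⟨d, hd, hdx⟩ := exists_mem_nonZeroDivisors_mem_denominatorIdeal (A := A) x
  have hloc : ∀ Q ∈ minimalRegularPrimes A, ∃ s ∉ P, s • x ∈ regularQuotientRing A Q := by
    intro Q hQ
    by_cases hQP : Q.asIdeal ≤ P
    · exact ⟨1, Ideal.one_notMem P, by simpa using hcon Q hQ hQP⟩
    · exact (hK.isManisDVR Q hQ).exists_notMem_smul_mem hA hQ.1 hQP x
  choose! s hsP hs using hloc
  have hfin := hK.finite_character d hd
  have hprod : (∏ Q ∈ hfin.toFinset, s Q) ∉ P := fun h ↦ by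
    obtain ⟨Q, hQ, hQP⟩ := Ideal.IsPrime.prod_mem_iff.mp h
    exact hsP Q (hfin.mem_toFinset.mp hQ).1 hQP
  have hmem : (∏ Q ∈ hfin.toFinset, s Q) • x ∈ (⊥ : Subalgebra A (FractionRing A)) := by
    rw [← hK.iInf_eq_bot]
    simp only [Algebra.mem_iInf]
    intro Q hQ
    by_cases hdQ : d ∈ Q.asIdeal
    · rw [← Finset.prod_erase_mul _ _ (hfin.mem_toFinset.mpr ⟨hQ, hdQ⟩), mul_smul]
      exact Subalgebra.smul_mem _ (hs Q hQ) _
    · exact Subalgebra.smul_mem _ (mem_regularQuotientRing_iff.mpr ⟨d, hdQ, hd, hdx⟩) _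
  exact hprod (hx (mem_denominatorIdeal.mpr (Algebra.mem_bot.mp hmem)))

theorem IsKrullRing.isPerinormal (hK : IsKrullRing A) (hA : IsMarotRing A) : IsPerinormal A := by
  refine fun B _ ↦ flat_of_hasGoingDown (IsFractionRing.injective A _) (fun P _ x hx ↦ ?_) B
  obtain ⟨Q, hQ, hQP, hxQ⟩ := hK.exists_minimalRegularPrime_le hA hx
  exact ⟨Q.asIdeal, hQP, Q.isPrime, (hK.isManisDVR Q hQ).exists_mem_smul_notMem hA hQ.1 hxQ⟩

end Krull

section KrullAkizuki

variable {R M : Type*} [AddCommGroup M]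

section Ring

variable [Ring R] [Module R M] (φ : Module.End R M)

theorem exists_ker_pow_sup_range_eq_top (hφ : ∀ m, ∃ n, (φ ^ n) m = 0)
    [IsArtinian R (LinearMap.ker φ)] :
    ∃ n, LinearMap.ker (φ ^ n) ⊔ LinearMap.range φ = ⊤ := by
  let L : ℕ →o (Submodule R (LinearMap.ker φ))ᵒᵈ :=
    { toFun k := OrderDual.toDual ((LinearMap.range (φ ^ k)).submoduleOf (LinearMap.ker φ))
      monotone' := fun i j hij ↦ Submodule.comap_mono (φ.iterateRange.monotone hij) }
  obtain ⟨n, hn⟩ := IsArtinian.monotone_stabilizes L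
  have hstep : ∀ k ≥ n, ∀ y, φ ((φ ^ k) y) = 0 → ∃ z, (φ ^ (k + 1)) z = (φ ^ k) y := by
    intro k hk y hy
    have hL : L k = L (k + 1) := (hn k hk).symm.trans (hn _ (hk.trans k.le_succ))
    have hmem : (⟨(φ ^ k) y, hy⟩ : LinearMap.ker φ) ∈ OrderDual.ofDual (L k) := ⟨y, rfl⟩
    rw [hL] at hmem
    exact hmem
  have hker : ∀ k m, (φ ^ k) m = 0 → m ∈ LinearMap.ker (φ ^ n) ⊔ LinearMap.range φ := by
    intro k
    induction k with
    | zero =>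
      rintro m (rfl : m = 0)
      exact zero_mem _
    | succ k ih =>
      intro m hm
      rcases lt_or_ge k n with hkn | hnk
      · refine Submodule.mem_sup_left (LinearMap.mem_ker.mpr ?_)
        rw [← Nat.sub_add_cancel hkn, pow_add, Module.End.mul_apply, hm, map_zero]
      · rw [pow_succ', Module.End.mul_apply] at hm
        obtain ⟨z, hz⟩ := hstep k hnk m hm
        rw [← sub_add_cancel m (φ z)]
        refine add_mem (ih _ ?_) (Submodule.mem_sup_right ⟨z, rfl⟩)
        rw [map_sub, ← hz, pow_succ, Module.End.mul_apply, sub_self]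
  refine ⟨n, eq_top_iff.mpr fun m _ ↦ ?_⟩
  obtain ⟨k, hk⟩ := hφ m
  exact hker k m hk

theorem isNoetherian_ker_pow [IsNoetherian R (LinearMap.ker φ)] (n : ℕ) :
    IsNoetherian R (LinearMap.ker (φ ^ n)) := by
  induction n with
  | zero =>
    rw [pow_zero, Module.End.one_eq_id, LinearMap.ker_id]
    infer_instance
  | succ n ih =>
    have hle : LinearMap.ker φ ≤ LinearMap.ker (φ ^ (n + 1)) :=
      LinearMap.ker_le_ker_comp φ (φ ^ n)
    let ψ : LinearMap.ker (φ ^ (n + 1)) →ₗ[R] LinearMap.ker (φ ^ n) := φ.restrict fun _ hm ↦ hm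
    refine isNoetherian_of_range_eq_ker (Submodule.inclusion hle) ψ ?_
    rw [Submodule.range_inclusion]
    exact (LinearMap.ker_restrict _).symm

theorem isNoetherian_quotient_range (hφ : ∀ m, ∃ n, (φ ^ n) m = 0)
    [IsNoetherian R (LinearMap.ker φ)] [IsArtinian R (LinearMap.ker φ)] :
    IsNoetherian R (M ⧸ LinearMap.range φ) := by
  obtain ⟨n, hn⟩ := exists_ker_pow_sup_range_eq_top φ hφ
  have := isNoetherian_ker_pow φ n
  refine isNoetherian_of_surjective ((LinearMap.range φ).mkQ ∘ₗ (LinearMap.ker (φ ^ n)).subtype) ?_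
  rw [LinearMap.range_comp, Submodule.range_subtype,
    Submodule.map_mkQ_eq_top, sup_comm, hn]

theorem isNoetherian_ker_mapQ {N : Submodule R M} [IsNoetherian R N]
    (hφ : Function.Injective φ) (hN : N ≤ N.comap φ) :
    IsNoetherian R (LinearMap.ker (N.mapQ N φ hN)) := by
  have : IsNoetherian R (N.comap φ) :=
    isNoetherian_of_injective (φ.restrict fun _ hm ↦ hm : N.comap φ →ₗ[R] N) fun a b hab ↦
      Subtype.ext (hφ (congrArg Subtype.val hab))
  rw [Submodule.ker_mapQ]
  infer_instance

end Ring

variable [CommRing R] [Module R M]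

theorem isArtinian_of_forall_pow_le_torsionOf [IsLocalRing R] [IsNoetherianRing R]
    [Module.Finite R M]
    (h : ∀ m : M, ∃ e, IsLocalRing.maximalIdeal R ^ e ≤ Ideal.torsionOf R M m) :
    IsArtinian R M := by
  obtain ⟨n, hn⟩ : ∃ n, IsLocalRing.maximalIdeal R ^ n ≤ Module.annihilator R M := by
    obtain ⟨G, hG⟩ := Module.Finite.fg_top (R := R) (M := M)
    choose e he using h
    refine ⟨G.sup e, ?_⟩
    rw [← Submodule.annihilator_top, ← hG]
    intro r hr
    rw [Submodule.mem_annihilator_span]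
    exact fun g ↦ he g (Ideal.pow_le_pow_right (Finset.le_sup g.2) hr)
  set I := IsLocalRing.maximalIdeal R ^ (n + 1)
  have hmin : IsLocalRing.maximalIdeal R ∈ I.minimalPrimes :=
    ⟨⟨inferInstance, Ideal.pow_le_self n.succ_ne_zero⟩,
      fun J hJ _ ↦ (hJ.1.pow_le_iff n.succ_ne_zero).mp hJ.2⟩
  have := IsLocalRing.quotient_artinian_of_mem_minimalPrimes_of_isLocalRing I hmin
  have htors : Module.IsTorsionBySet R M I := fun m r ↦
    Module.mem_annihilator.mp (hn (Ideal.pow_le_pow_right n.le_succ r.2)) m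
  let := htors.module
  have : IsScalarTower R (R ⧸ I) M := htors.isScalarTower
  have : Module.Finite (R ⧸ I) M := Module.Finite.of_restrictScalars_finite R (R ⧸ I) M
  exact isArtinian_of_surjective_algebraMap (R := R ⧸ I) (S := R) (M := M)
    Ideal.Quotient.mk_surjective

variable (p : Ideal R) [p.IsPrime]

theorem pow_maximalIdeal_le_torsionOf_mk {e : ℕ} {m : M} (h : p ^ e ≤ Ideal.torsionOf R M m)
    (s : p.primeCompl) :
    IsLocalRing.maximalIdeal (Localization.AtPrime p) ^ e ≤
      Ideal.torsionOf (Localization.AtPrime p) _ (LocalizedModule.mk m s) := by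
  rw [← Localization.AtPrime.map_eq_maximalIdeal, ← Ideal.map_pow, Ideal.map_le_iff_le_comap]
  intro r hr
  rw [Ideal.mem_comap, Ideal.mem_torsionOf_iff, algebraMap_smul, LocalizedModule.smul'_mk,
    (Ideal.mem_torsionOf_iff m r).mp (h hr), LocalizedModule.zero_mk]

theorem isNoetherian_localizedModule_quotient_range [IsNoetherianRing R] (φ : Module.End R M)
    (hφ : ∀ m, ∃ n, (φ ^ n) m = 0) [Module.Finite R (LinearMap.ker φ)]
    (htors : ∀ m, ∃ e, p ^ e ≤ Ideal.torsionOf R M m) :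
    IsNoetherian (Localization.AtPrime p)
      (LocalizedModule p.primeCompl (M ⧸ LinearMap.range φ)) := by
  let φp : Module.End (Localization.AtPrime p) (LocalizedModule p.primeCompl M) :=
    LocalizedModule.map p.primeCompl φ
  have hmk : ∀ (n : ℕ) m s,
      (φp ^ n) (LocalizedModule.mk m s) = LocalizedModule.mk ((φ ^ n) m) s := by
    intro n
    induction n with
    | zero => exact fun _ _ ↦ rfl
    | succ n ih =>
      intro m s
      rw [pow_succ', Module.End.mul_apply, ih, pow_succ', Module.End.mul_apply]
      exact LocalizedModule.map_mk _ _ _ _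
  have hφp : ∀ m, ∃ n, (φp ^ n) m = 0 := fun m ↦ by
    induction m using LocalizedModule.induction_on with | h m s
    obtain ⟨n, hn⟩ := hφ m
    exact ⟨n, by rw [hmk, hn, LocalizedModule.zero_mk]⟩
  have hker : LinearMap.ker φp = (LinearMap.ker φ).localized p.primeCompl :=
    (LinearMap.localized'_ker_eq_ker_localizedMap _ _ _ _ _).symm
  have hrange : LinearMap.range φp = (LinearMap.range φ).localized p.primeCompl :=
    (LinearMap.localized'_range_eq_range_localizedMap _ _ _ _ _).symm
  have : Module.Finite (Localization.AtPrime p) (LinearMap.ker φp) := by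
    rw [hker, Module.Finite.iff_fg]
    exact Submodule.localized_fg _ (Module.Finite.iff_fg.mp inferInstance)
  have : IsArtinian (Localization.AtPrime p) (LinearMap.ker φp) := by
    refine isArtinian_of_forall_pow_le_torsionOf ?_
    rintro ⟨m, hm⟩
    induction m using LocalizedModule.induction_on with | h m s
    obtain ⟨e, he⟩ := htors m
    exact ⟨e, fun r hr ↦ Subtype.ext (pow_maximalIdeal_le_torsionOf_mk p he s hr)⟩
  have := isNoetherian_quotient_range φp hφp
  rw [hrange] at this
  exact isNoetherian_of_linearEquiv (localizedQuotientEquiv p.primeCompl (LinearMap.range φ))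

theorem exists_smul_mem_span_image_Iio_of_isNoetherian_localizedModule (S : Submonoid R)
    [IsNoetherian (Localization S) (LocalizedModule S M)] (u : ℕ → M) :
    ∃ k, ∃ s ∈ S, s • u k ∈ Submodule.span R (u '' Set.Iio k) := by
  let W : ℕ →o Submodule R M :=
    ⟨fun k ↦ Submodule.span R (u '' Set.Iio k), fun i j hij ↦
      Submodule.span_mono (Set.image_mono (Set.Iio_subset_Iio hij))⟩
  obtain ⟨k, hk⟩ := monotone_stabilizes_iff_noetherian.mpr
    ‹IsNoetherian (Localization S) (LocalizedModule S M)›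
    ⟨fun k ↦ (W k).localized S, fun i j hij ↦
      (Submodule.localized'gi _ _ _).gc.monotone_l (W.monotone hij)⟩
  have hmem : LocalizedModule.mkLinearMap S M (u k) ∈ (W k).localized S := by
    have hk : (W k).localized S = (W (k + 1)).localized S := hk (k + 1) k.le_succ
    rw [hk]
    exact ⟨u k, Submodule.subset_span ⟨k, k.lt_succ_self, rfl⟩, 1,
      IsLocalizedModule.mk'_one _ _ _⟩
  obtain ⟨w, hw, s, hs⟩ := hmem
  rw [IsLocalizedModule.mk'_eq_iff, Submonoid.smul_def, ← map_smul,
    IsLocalizedModule.eq_iff_exists S] at hs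
  obtain ⟨c, hc⟩ := hs
  refine ⟨k, c * s, S.mul_mem c.2 s.2, ?_⟩
  have hcs : ((c : R) * (s : R)) • u k = (c : R) • w := by rw [mul_smul]; exact hc.symm
  exact hcs ▸ Submodule.smul_mem _ _ hw

theorem exists_smul_mem_span_image_Iio_sup [IsNoetherianRing R] {N : Submodule R M} (hN : N.FG)
    {φ : Module.End R M} (hinj : Function.Injective φ) (hφN : N ≤ N.comap φ)
    (hφ : ∀ m, ∃ n, (φ ^ n) m ∈ N) (htors : ∀ m, ∃ e, p ^ e ≤ N.colon {m}) (u : ℕ → M) :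
    ∃ k, ∃ s ∉ p, s • u k ∈ N ⊔ (Submodule.span R (u '' Set.Iio k) ⊔ LinearMap.range φ) := by
  have : Module.Finite R N := Module.Finite.iff_fg.mpr hN
  have : Module.Finite R (LinearMap.ker (N.mapQ N φ hφN)) :=
    have := isNoetherian_ker_mapQ φ hinj hφN
    inferInstance
  have hnil : ∀ m : M ⧸ N, ∃ n, (N.mapQ N φ hφN ^ n) m = 0 := fun m ↦ by
    obtain ⟨m, rfl⟩ := N.mkQ_surjective m
    refine (hφ m).imp fun n hn ↦ ?_
    have hcomm : N.mapQ N φ hφN ∘ₗ N.mkQ = N.mkQ ∘ₗ φ := N.mapQ_mkQ N φ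
    have hpow := LinearMap.congr_fun (Module.End.commute_pow_left_of_commute hcomm n) m
    exact hpow.trans ((Submodule.Quotient.mk_eq_zero N).mpr hn)
  have htors' : ∀ m : M ⧸ N, ∃ e, p ^ e ≤ Ideal.torsionOf R (M ⧸ N) m := fun m ↦ by
    obtain ⟨m, rfl⟩ := N.mkQ_surjective m
    refine (htors m).imp fun e he r hr ↦ ?_
    rw [Ideal.mem_torsionOf_iff, ← map_smul, Submodule.mkQ_apply, Submodule.Quotient.mk_eq_zero]
    exact Submodule.mem_colon_singleton.mp (he hr)
  have := isNoetherian_localizedModule_quotient_range p (N.mapQ N φ hφN) hnil htors'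
  obtain ⟨k, s, hs, hk⟩ := exists_smul_mem_span_image_Iio_of_isNoetherian_localizedModule
    p.primeCompl (fun i ↦ (LinearMap.range (N.mapQ N φ hφN)).mkQ (N.mkQ (u i)))
  have hspan : Submodule.span R
      ((fun i ↦ (LinearMap.range (N.mapQ N φ hφN)).mkQ (N.mkQ (u i))) '' Set.Iio k) =
      (Submodule.span R (u '' Set.Iio k)).map
        ((LinearMap.range (N.mapQ N φ hφN)).mkQ ∘ₗ N.mkQ) := by
    rw [Submodule.map_span, Set.image_image]
    rfl
  refine ⟨k, s, hs, ?_⟩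
  rw [hspan, Submodule.map_comp, ← map_smul, ← map_smul, ← Submodule.mem_comap,
    Submodule.comap_map_mkQ, Submodule.range_mapQ, ← Submodule.map_sup, ← Submodule.mem_comap,
    Submodule.comap_map_mkQ, sup_comm (LinearMap.range φ)] at hk
  exact hk

end KrullAkizuki

section Transcendental

variable {A K : Type*} [CommRing A] [CommRing K] [Algebra A K]

theorem ker_aeval_le_map_C [IsIntegrallyClosedIn A K] {Q : Ideal A} {x : K}
    (hx : ∀ a y, algebraMap A K y = a • x → a ∈ Q ∧ y ∈ Q) :
    RingHom.ker (aeval x : A[X] →ₐ[A] K) ≤ Q.map C := by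
  obtain ⟨hinj, hclosed⟩ := isIntegrallyClosedIn_iff.mp ‹IsIntegrallyClosedIn A K›
  intro f hf
  rw [RingHom.mem_ker] at hf
  induction hn : f.natDegree using Nat.strong_induction_on generalizing f with | h n ih
  cases n with
  | zero =>
    rw [eq_C_of_natDegree_eq_zero hn, aeval_C, map_eq_zero_iff _ hinj] at hf
    rw [eq_C_of_natDegree_eq_zero hn, hf, C_0]
    exact zero_mem _
  | succ n =>
    -- A leading coefficient times `x` is integral, so it can be absorbed in the next coefficient.
    obtain ⟨y, hy⟩ := hclosed (isIntegral_leadingCoeff_smul f x hf)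
    obtain ⟨hlQ, hyQ⟩ := hx _ _ hy
    let g := f.eraseLead + C y * X ^ n
    have hfg : f = g + (C f.leadingCoeff * X ^ (n + 1) - C y * X ^ n) := by
      conv_lhs => rw [← f.eraseLead_add_C_mul_X_pow, hn]
      ring
    have hg : aeval x g = 0 := by
      rw [hfg, map_add] at hf
      simpa [hy, Algebra.smul_def, pow_succ', mul_assoc] using hf
    have hgn : g.natDegree < n + 1 := by
      refine Nat.lt_succ_of_le ((natDegree_add_le _ _).trans
        (max_le ?_ (natDegree_C_mul_X_pow_le y n)))
      exact f.eraseLead_natDegree_le.trans_eq (by rw [hn, Nat.add_sub_cancel])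
    rw [hfg]
    exact add_mem (ih _ hgn hg rfl) (sub_mem
      (Ideal.mul_mem_right _ _ (Ideal.mem_map_of_mem C hlQ))
      (Ideal.mul_mem_right _ _ (Ideal.mem_map_of_mem C hyQ)))

theorem exists_pow_le_colon_of_mem_minimalPrimes {I Q : Ideal A} (hQ : Q ∈ I.minimalPrimes)
    {J : Ideal A} (hJ : J.FG) (hJQ : J ≤ Q) : ∃ s ∉ Q, ∃ n : ℕ, J ^ n ≤ I.colon {s} := by
  have := hQ.1.1
  induction J, hJ using Submodule.fg_induction with
  | singleton r =>
    have hr : algebraMap A (Localization.AtPrime Q) r ∈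
        (I.map (algebraMap A (Localization.AtPrime Q))).radical := by
      rw [IsLocalization.AtPrime.radical_map_of_mem_minimalPrimes
        (A := Localization.AtPrime Q) Q I hQ]
      exact Ideal.mem_map_of_mem _ (hJQ (Ideal.mem_span_singleton_self r))
    obtain ⟨n, hn⟩ := hr
    rw [← map_pow] at hn
    obtain ⟨s, hs, hsr⟩ := (IsLocalization.algebraMap_mem_map_algebraMap_iff Q.primeCompl
      (Localization.AtPrime Q) I (r ^ n)).mp hn
    refine ⟨s, hs, n, ?_⟩
    change Ideal.span {r} ^ n ≤ _
    rw [Ideal.span_singleton_pow, Ideal.span_singleton_le_iff_mem,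
      Submodule.mem_colon_singleton, smul_eq_mul, mul_comm]
    exact hsr
  | sup J₁ J₂ _ _ h₁ h₂ =>
    obtain ⟨s, hs, m, hm⟩ := h₁ (le_sup_left.trans hJQ)
    obtain ⟨t, ht, n, hn⟩ := h₂ (le_sup_right.trans hJQ)
    refine ⟨s * t, fun h ↦ (hQ.1.1.mem_or_mem h).elim hs ht, m + n, ?_⟩
    refine Ideal.sup_pow_add_le_pow_sup_pow.trans (sup_le (hm.trans ?_) (hn.trans ?_))
    · intro a ha
      rw [Submodule.mem_colon_singleton, smul_eq_mul] at ha ⊢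
      rw [← mul_assoc]
      exact I.mul_mem_right t ha
    · intro a ha
      rw [Submodule.mem_colon_singleton, smul_eq_mul] at ha ⊢
      rw [mul_left_comm]
      exact I.mul_mem_left s ha

end Transcendental

section Integral

variable {R A K : Type*} [CommRing R] [CommRing A] [CommRing K] [Algebra R A] [Algebra A K]

theorem exists_subalgebra_finite_forall_mem_denominatorIdeal [Algebra.IsIntegral R A] {x : K}
    {T : Set A} (hT : T.Finite) (hTx : T ⊆ denominatorIdeal A x) :
    ∃ S : Subalgebra R A, Module.Finite R S ∧
      ∀ a ∈ T, ∃ ha : a ∈ S, ⟨a, ha⟩ ∈ denominatorIdeal S x := by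
  have hex : ∀ a ∈ T, ∃ y, algebraMap A K y = a • x := fun a ha ↦
    mem_denominatorIdeal.mp (hTx ha)
  choose! y hy using hex
  have hfg := fg_adjoin_of_finite (hT.union (hT.image y))
    fun a _ ↦ Algebra.IsIntegral.isIntegral (R := R) a
  refine ⟨Algebra.adjoin R (T ∪ y '' T), Module.Finite.iff_fg.mpr hfg, fun a ha ↦ ?_⟩
  exact ⟨Algebra.subset_adjoin (.inl ha), mem_denominatorIdeal.mpr
      ⟨⟨y a, Algebra.subset_adjoin (.inr ⟨a, ha, rfl⟩)⟩, hy a ha⟩⟩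

theorem one_sup_span_image_pow_succ_le_map_degreeLT {S T : Type*} [CommRing S] [CommRing T]
    [Algebra R S] [Algebra S T] [Algebra R T] [IsScalarTower R S T] (y : T) (k : ℕ) :
    (1 : Submodule S T).restrictScalars R ⊔
        Submodule.span R ((fun i ↦ y ^ (i + 1)) '' Set.Iio k) ≤
      ((degreeLT S (k + 1)).map (aeval y).toLinearMap).restrictScalars R := by
  refine sup_le (fun z hz ↦ ?_) (Submodule.span_le.mpr ?_)
  · obtain ⟨c, rfl⟩ := Submodule.mem_one.mp hz
    have hdeg : (C c).degree < (k + 1 : ℕ) :=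
      degree_C_le.trans_lt (WithBot.coe_pos.mpr k.succ_pos)
    exact ⟨C c, mem_degreeLT.mpr hdeg, aeval_C y c⟩
  · rintro _ ⟨i, hi, rfl⟩
    have hdeg : (X ^ (i + 1) : S[X]).degree < (k + 1 : ℕ) :=
      (degree_X_pow_le _).trans_lt (WithBot.coe_lt_coe.mpr (Nat.succ_lt_succ hi))
    exact ⟨X ^ (i + 1), mem_degreeLT.mpr hdeg, aeval_X_pow y⟩

variable [IsNoetherianRing R]

theorem exists_smul_pow_eq_add_of_surjective_aeval {S T : Type*} [CommRing S] [CommRing T]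
    [Algebra R S] [Algebra S T] [Algebra R T] [IsScalarTower R S T] [Module.Finite R S]
    (p : Ideal R) [p.IsPrime] {y : T} (hy : Function.Surjective (aeval y : S[X] →ₐ[S] T)) {d : S}
    (hd : IsSMulRegular T d) (hdy : d ∈ denominatorIdeal S y) {n : ℕ}
    (hp : p.map (algebraMap R S) ^ n ≤ denominatorIdeal S y) :
    ∃ k : ℕ, ∃ f g : S[X], f.degree < k ∧ ∃ s ∉ p, s • y ^ k = aeval y f + d • aeval y g := by
  let N : Submodule R T := (1 : Submodule S T).restrictScalars R
  have hN : N.FG := by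
    have hrange : N = LinearMap.range ((Algebra.linearMap S T).restrictScalars R) := by
      rw [LinearMap.range_restrictScalars, ← Submodule.one_eq_range]
    rw [hrange, ← Module.Finite.iff_fg]
    infer_instance
  let φ : Module.End R T := Algebra.lsmul R R T d
  have hφ : ∀ z, ∃ e, (φ ^ e) z ∈ N := fun z ↦ by
    obtain ⟨f, rfl⟩ := hy z
    obtain ⟨e, he⟩ := exists_pow_le_denominatorIdeal_aeval (I := Ideal.span {d}) (n := 1)
      (by rwa [pow_one, Ideal.span_singleton_le_iff_mem]) f
    refine ⟨e, ?_⟩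
    rw [← map_pow]
    exact Submodule.mem_colon_singleton.mp
      (he (Ideal.pow_mem_pow (Ideal.mem_span_singleton_self d) e))
  have htors : ∀ z, ∃ e, p ^ e ≤ N.colon {z} := fun z ↦ by
    obtain ⟨f, rfl⟩ := hy z
    obtain ⟨e, he⟩ := exists_pow_le_denominatorIdeal_aeval hp f
    refine ⟨e, fun r hr ↦ Submodule.mem_colon_singleton.mpr ?_⟩
    rw [← algebraMap_smul S]
    rw [← Ideal.map_pow] at he
    exact Submodule.mem_colon_singleton.mp (he (Ideal.mem_map_of_mem _ hr))
  obtain ⟨k, s, hs, hk⟩ := exists_smul_mem_span_image_Iio_sup p hN (φ := φ) hd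
    (fun z hz ↦ Submodule.smul_mem (1 : Submodule S T) d hz) hφ htors (fun i ↦ y ^ (i + 1))
  rw [← sup_assoc] at hk
  obtain ⟨_, hw, _, ⟨z, rfl⟩, h⟩ := Submodule.mem_sup.mp hk
  obtain ⟨f, hf, rfl⟩ := one_sup_span_image_pow_succ_le_map_degreeLT y k hw
  obtain ⟨g, rfl⟩ := hy z
  exact ⟨k + 1, f, g, mem_degreeLT.mp hf, s, hs, h.symm⟩

theorem exists_smul_pow_eq_add_of_finite {S K : Type*} [CommRing S] [CommRing K] [Algebra R S]
    [Algebra S K] [Algebra R K] [IsScalarTower R S K] [Module.Finite R S] (p : Ideal R) [p.IsPrime]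
    {x : K} {d : S} (hd : IsSMulRegular K d) (hdx : d ∈ denominatorIdeal S x) {n : ℕ}
    (hp : p.map (algebraMap R S) ^ n ≤ denominatorIdeal S x) :
    ∃ k : ℕ, ∃ f g : S[X], f.degree < k ∧ ∃ s ∉ p, s • x ^ k = aeval x f + d • aeval x g := by
  let y : (aeval x : S[X] →ₐ[S] K).range := ⟨x, X, aeval_X x⟩
  have haeval : ∀ f : S[X], (aeval y f : K) = aeval x f := fun f ↦ (Subalgebra.aeval_coe _ y f).symm
  have hy : Function.Surjective (aeval y : S[X] →ₐ[S] _) := by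
    rintro ⟨_, f, rfl⟩
    exact ⟨f, Subtype.ext (haeval f)⟩
  have hden : denominatorIdeal S x = denominatorIdeal S y := by
    ext a
    simp only [mem_denominatorIdeal]
    exact exists_congr fun b ↦ ⟨fun h ↦ Subtype.ext h, fun h ↦ congrArg Subtype.val h⟩
  rw [hden] at hdx hp
  obtain ⟨k, f, g, hf, s, hs, h⟩ := exists_smul_pow_eq_add_of_surjective_aeval p hy
    (fun a b hab ↦ Subtype.ext (hd (congrArg Subtype.val hab))) hdx hp
  refine ⟨k, f, g, hf, s, hs, ?_⟩
  rw [← haeval, ← haeval]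
  exact congrArg Subtype.val h

variable [Algebra R K] [IsScalarTower R A K]

theorem exists_smul_pow_eq_add_of_isIntegral [Algebra.IsIntegral R A] (p : Ideal R)
    [p.IsPrime] {x : K} {d : A}
    (hd : IsSMulRegular K d) (hdx : d ∈ denominatorIdeal A x) {n : ℕ}
    (hp : p.map (algebraMap R A) ^ n ≤ denominatorIdeal A x) :
    ∃ k : ℕ, ∃ f g : A[X], f.degree < k ∧ ∃ s ∉ p, s • x ^ k = aeval x f + d • aeval x g := by
  obtain ⟨G, hG⟩ := IsNoetherian.noetherian (p ^ n)
  rw [← Ideal.map_pow, ← hG, Ideal.map_le_iff_le_comap, Submodule.span_le] at hp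
  have hT : insert d (algebraMap R A '' G) ⊆ (denominatorIdeal A x : Set A) :=
    Set.insert_subset hdx (Set.image_subset_iff.mpr hp)
  obtain ⟨S, hS, hTS⟩ := exists_subalgebra_finite_forall_mem_denominatorIdeal (R := R)
    ((G.finite_toSet.image _).insert d) hT
  obtain ⟨hdS, hdx⟩ := hTS d (Set.mem_insert _ _)
  have hpS : p.map (algebraMap R S) ^ n ≤ denominatorIdeal S x := by
    rw [← Ideal.map_pow, ← hG, Ideal.map_le_iff_le_comap, Submodule.span_le]
    exact fun r hr ↦ (hTS _ (Set.mem_insert_of_mem _ ⟨r, hr, rfl⟩)).2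
  obtain ⟨k, f, g, hf, s, hs, h⟩ :=
    exists_smul_pow_eq_add_of_finite (S := S) p (d := ⟨d, hdS⟩) hd hdx hpS
  refine ⟨k, f.map (algebraMap S A), g.map (algebraMap S A), degree_map_le.trans_lt hf,
    s, hs, ?_⟩
  rw [aeval_map_algebraMap, aeval_map_algebraMap]
  exact h

variable (R)

theorem exists_smul_notMem_of_mem_minimalPrimes_denominatorIdeal [Algebra.IsIntegral R A]
    [IsIntegrallyClosedIn A K] {x : K} {d : A} (hd : IsSMulRegular K d)
    (hdx : d ∈ denominatorIdeal A x) {Q : Ideal A} (hQ : Q ∈ (denominatorIdeal A x).minimalPrimes) :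
    ∃ a : A, ∃ y ∉ Q, algebraMap A K y = a • x := by
  have := hQ.1.1
  by_contra! hcon
  obtain ⟨s, hs, n, hn⟩ := exists_pow_le_colon_of_mem_minimalPrimes hQ
    (Ideal.FG.map (IsNoetherian.noetherian (Q.under R)) (algebraMap R A)) Ideal.map_comap_le
  have hx : ∀ a y : A, algebraMap A K y = a • s • x → a ∈ Q ∧ y ∈ Q := fun a y h ↦ by
    rw [smul_smul] at h
    have hasQ : a * s ∈ Q := hQ.1.2 (mem_denominatorIdeal.mpr ⟨y, h⟩)
    exact ⟨(hQ.1.1.mem_or_mem hasQ).resolve_right hs, by_contra fun hy ↦ hcon _ y hy h⟩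
  obtain ⟨k, f, g, hf, t, ht, h⟩ := exists_smul_pow_eq_add_of_isIntegral (Q.under R) (x := s • x)
    hd (mem_denominatorIdeal_smul.mpr (Ideal.mul_mem_right _ _ hdx))
    (hn.trans fun a ha ↦ mem_denominatorIdeal_smul.mpr (Submodule.mem_colon_singleton.mp ha))
  have hker : C (algebraMap R A t) * X ^ k - f - C d * g ∈
      RingHom.ker (aeval (s • x) : A[X] →ₐ[A] K) := by
    rw [RingHom.mem_ker, map_sub, map_sub, map_mul, aeval_C, map_pow, aeval_X,
      ← Algebra.smul_def, algebraMap_smul, h, map_mul, aeval_C, ← Algebra.smul_def]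
    abel
  have hcoeff := Ideal.mem_map_C_iff.mp (ker_aeval_le_map_C hx hker) k
  rw [coeff_sub, coeff_sub, coeff_C_mul_X_pow, if_pos rfl, coeff_eq_zero_of_degree_lt hf,
    sub_zero, coeff_C_mul] at hcoeff
  exact ht ((Q.sub_mem_iff_left (Q.mul_mem_right _ (hQ.1.2 hdx))).mp hcoeff)

theorem isPerinormal_of_isIntegral [Algebra.IsIntegral R A] [IsIntegrallyClosed A] :
    IsPerinormal A := by
  refine fun B _ ↦ flat_of_hasGoingDown (IsFractionRing.injective A _) (fun P _ x hx ↦ ?_) B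
  obtain ⟨d, hd, hdx⟩ := exists_mem_nonZeroDivisors_mem_denominatorIdeal (A := A) x
  have hreg : IsSMulRegular (FractionRing A) d := by
    rw [IsSMulRegular]
    simp only [Algebra.smul_def]
    exact (IsLocalization.map_units (FractionRing A) (⟨d, hd⟩ : A⁰)).mul_right_injective
  obtain ⟨Q, hQ, hQP⟩ := Ideal.exists_minimalPrimes_le hx
  obtain ⟨a, y, hy, hay⟩ :=
    exists_smul_notMem_of_mem_minimalPrimes_denominatorIdeal R hreg hdx hQ
  exact ⟨Q, hQP, hQ.1.1, a, hQ.1.2 (mem_denominatorIdeal.mpr ⟨y, hay⟩), y, hy, hay⟩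

end Integral

section IntegralClosure

variable (R K : Type*) [CommRing R] [CommRing K] [Algebra R K] [IsFractionRing R K]

theorem isFractionRing_subalgebra (B : Subalgebra R K) : IsFractionRing B K := by
  have hinj : Function.Injective (algebraMap B K) := Subtype.val_injective
  have hunit : ∀ s ∈ R⁰, IsUnit (algebraMap R K s) := fun s hs ↦
    IsLocalization.map_units K (⟨s, hs⟩ : R⁰)
  refine (isLocalization_iff _ _).mpr
    ⟨fun b ↦ ?_, fun z ↦ ?_, fun {a b} hab ↦ ⟨1, by rw [hinj hab]⟩⟩
  · have hb : algebraMap B K b ∈ K⁰ := mem_nonZeroDivisors_iff_right.mpr fun z hz ↦ by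
      obtain ⟨s, hs, hsz⟩ := exists_mem_nonZeroDivisors_mem_denominatorIdeal (A := R) z
      obtain ⟨r, hr⟩ := mem_denominatorIdeal.mp hsz
      rw [Algebra.smul_def] at hr
      have hr0 : algebraMap R B r = 0 :=
        mem_nonZeroDivisors_iff_right.mp b.2 _ (hinj (by
          rw [map_mul, map_zero, ← IsScalarTower.algebraMap_apply, hr, mul_assoc, hz, mul_zero]))
      rw [← (hunit s hs).mul_right_eq_zero, ← hr, IsScalarTower.algebraMap_apply R B K, hr0,
        map_zero]
    rwa [IsFractionRing.nonZeroDivisors_eq_isUnit R K] at hb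
  · obtain ⟨s, hs, hsz⟩ := exists_mem_nonZeroDivisors_mem_denominatorIdeal (A := R) z
    obtain ⟨r, hr⟩ := mem_denominatorIdeal.mp hsz
    refine ⟨⟨algebraMap R B r, algebraMap R B s, ?_⟩, ?_⟩
    · exact mem_nonZeroDivisors_of_injective hinj (hunit s hs).mem_nonZeroDivisors
    · exact (mul_comm _ _).trans ((Algebra.smul_def s z).symm.trans hr.symm)

theorem isIntegrallyClosed_integralClosure : IsIntegrallyClosed (integralClosure R K) := by
  have := isFractionRing_subalgebra R K (integralClosure R K)
  exact (isIntegrallyClosed_iff_isIntegrallyClosedIn K).mpr inferInstance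

end IntegralClosure

end ZeroDivisorRing

theorem corollary20_general :
    (∀ (A : Type*) [CommRing A],
      ZeroDivisorRing.IsMarotRing A → ZeroDivisorRing.IsKrullRing A →
        ZeroDivisorRing.IsPerinormal A) ∧
    (∀ (R : Type*) [CommRing R] [IsNoetherianRing R]
      (A : Type*) [CommRing A] [Algebra R A] [Algebra.IsIntegral R A] [IsIntegrallyClosed A],
        ZeroDivisorRing.IsPerinormal A) :=
  ⟨fun _ _ hA hK ↦ hK.isPerinormal hA,
    fun R _ _ A _ _ _ _ ↦ ZeroDivisorRing.isPerinormal_of_isIntegral R (A := A)⟩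

theorem corollary20 :
    (∀ (A : Type*) [CommRing A],
      ZeroDivisorRing.IsMarotRing A → ZeroDivisorRing.IsKrullRing A →
        ZeroDivisorRing.IsPerinormal A) ∧
    (∀ (R : Type*) [CommRing R] [IsNoetherianRing R]
      (K : Type*) [CommRing K] [Algebra R K] [IsFractionRing R K],
        ZeroDivisorRing.IsPerinormal (integralClosure R K)) :=
  let ⟨hKrull, hIntegral⟩ := corollary20_general
  ⟨hKrull, fun R _ _ K _ _ _ ↦
    have := ZeroDivisorRing.isIntegrallyClosed_integralClosure R K
    hIntegral R (integralClosure R K)⟩
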